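/- Let $L\ge 1$ be an integer and $\lambda_\ell,\lambda_e>0$. Let $\Pi_\ell=\{x_i\}_{i\ge1}$ (legitimate nodes) and $\Pi_e=\{e_k\}_{k\ge1}$ (eavesdroppers) be independent homogeneous Poisson point processes in $\mathbb{R}^2$ with densities $\lambda_\ell$ and $\lambda_e$. Add a legitimate node $x_0=0$ at the origin (the typical node). Let $(\phi_i)_{i\ge0}$ be random offset angles with an arbitrary joint distribution, independent of the (enumerated) processes $(x_i)_{i\ge1}$, $(e_k)_{k\ge1}$, and for $1\le l\le L$ let $$\mathcal{S}_i^{(l)}=\Bigl\{z\in\mathbb{R}^2:\ \phi_i+(l-1)\tfrac{2\pi}{L}<\angle\overrightarrow{x_iz}<\phi_i+l\,\tfrac{2\pi}{L}\Bigr\}$$ (polar angles taken modulo $2\pi$) be the $L$ transmission sectors of node $x_i$. Consider the directed graph $G_L$ on the nodes $\{x_i\}_{i\ge0}$ with an edge $\overrightarrow{x_ix_j}$ if and only if $x_j$ lies in some sector $\mathcal{S}_i^{(l)}$ and $|x_i-x_j|<|x_i-e|$ for every eavesdropper $e\in\Pi_e\cap\mathcal{S}_i^{(l)}$ in the same sector.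 Let $N_{\mathrm{out}}$ and $N_{\mathrm{in}}$ be the out-degree and the in-degree of the typical node $x_0$ in $G_L$. Then $N_{\mathrm{out}}$ has the negative binomial distribution $$\mathbb{P}\{N_{\mathrm{out}}=n\}=\binom{L+n-1}{L-1}\left(\frac{\lambda_\ell}{\lambda_\ell+\lambda_e}\right)^{n}\left(\frac{\lambda_e}{\lambda_\ell+\lambda_e}\right)^{L},\qquad n\ge 0,$$ and $$\mathbb{E}\{N_{\mathrm{in}}\}=\mathbb{E}\{N_{\mathrm{out}}\}=L\,\frac{\lambda_\ell}{\lambda_e}.$$ -/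

import Mathlib

open MeasureTheory ProbabilityTheory
open scoped ENNReal

/-- The Euclidean plane. -/
abbrev Plane : Type := EuclideanSpace ℝ (Fin 2)

/-- The `l`-th (`l = 0, …, L - 1`) of the `L` open transmission sectors with apex `x` and offset
angle `φ`: the points `z ≠ x` such that some determination `θ` of the polar angle of the vector
from `x` to `z` satisfies `φ + l * (2π / L) < θ < φ + (l + 1) * (2π / L)`. -/
def sector (L : ℕ) (x : Plane) (φ : ℝ) (l : Fin L) : Set Plane :=
  {z | ∃ r θ : ℝ, 0 < r ∧
    φ + (l : ℝ) * (2 * Real.pi / L) < θ ∧ θ < φ + ((l : ℝ) + 1) * (2 * Real.pi / L) ∧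
    z = x + !₂[r * Real.cos θ, r * Real.sin θ]}

/-- The secrecy graph with `L` sectors: legitimate nodes at the positions `x i`, with offset angles
`φ i`, and eavesdroppers at the positions `e k`. There is an edge from `i` to `j` iff the node `j`
lies in one of the sectors of the node `i`, and is closer to the node `i` than every eavesdropper
that lies in this same sector. -/
def sectorGraph {ι κ : Type*} (L : ℕ) (x : ι → Plane) (φ : ι → ℝ) (e : κ → Plane) : Digraph ι where
  Adj i j := ∃ l : Fin L, x j ∈ sector L (x i) (φ i) l ∧
    ∀ k, e k ∈ sector L (x i) (φ i) l → dist (x i) (x j) < dist (x i) (e k)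

/-- The number of edges that leave a vertex. -/
noncomputable def outDegree {ι : Type*} (G : Digraph ι) (i : ι) : ℕ∞ := {j | G.Adj i j}.encard

/-- The number of edges that enter a vertex. -/
noncomputable def inDegree {ι : Type*} (G : Digraph ι) (i : ι) : ℕ∞ := {j | G.Adj j i}.encard

/-- The number of points of the random sequence `X` in the set `B`. -/
noncomputable def pointCount {Ω : Type*} (X : ℕ → Ω → Plane) (B : Set Plane) (ω : Ω) : ℕ∞ :=
  {i | X i ω ∈ B}.encard

/-- The random points `X 0, X 1, …` form (an enumeration of) a homogeneous Poisson point process of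
density `lam` in the plane: the number of points in a Borel set of finite area `a` is Poisson
distributed with mean `lam * a`, and the numbers of points in disjoint sets are independent. -/
structure IsPoissonProcess {Ω : Type*} [MeasurableSpace Ω] (μ : Measure Ω) (X : ℕ → Ω → Plane)
    (lam : ℝ) : Prop where
  measurable : ∀ i, Measurable (X i)
  count_law : ∀ B : Set Plane, MeasurableSet B → volume B ≠ ∞ → ∀ n : ℕ,
    μ {ω | pointCount X B ω = n} =
      ENNReal.ofReal (Real.exp (-(lam * volume.real B)) * (lam * volume.real B) ^ n / n.factorial)
  count_indep : ∀ (m : ℕ) (B : Fin m → Set Plane),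
    (∀ a, MeasurableSet (B a)) → (∀ a, volume (B a) ≠ ∞) → Pairwise (Function.onFun Disjoint B) →
    iIndepFun (fun a => pointCount X (B a)) μ

/-- The positions of the legitimate nodes once a node, of index `0`, has been added at the origin
to the points `x 0, x 1, …`. -/
def addOrigin (x : ℕ → Plane) : ℕ → Plane
  | 0 => 0
  | i + 1 => x i

/-- One realization of the Poisson secrecy graph with `L` sectors, seen from its typical node: the
legitimate nodes are the points `X i ω` and the typical node at the origin. -/
def typicalGraph {Ω : Type*} (L : ℕ) (X E : ℕ → Ω → Plane) (Φ : ℕ → Ω → ℝ) (ω : Ω) : Digraph ℕ :=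
  sectorGraph L (addOrigin fun i => X i ω) (fun i => Φ i ω) (fun k => E k ω)

/-! Law of the out-degree. In each sector of the origin, the reachable points form the part in front
of the nearest eavesdropper, and its area `V l` is at least `v` exactly when the truncated sector of
area `v` holds no eavesdropper (`ofReal_le_volume_clearSector_iff`). Void probabilities make `V l`
exponential of rate `lamE`, and counts on disjoint sets make the `L` areas independent
(`IsPoissonProcess.map_volume_clearSector`, `IsPoissonProcess.iIndepFun_volume_clearSector`). Given
the eavesdroppers and the angle, the out-degree is Poisson of mean `lamL * ∑ l, V l`. A Poisson
variable with exponentially distributed mean is geometric, and the sum of `L` independent geometric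
variables is negative binomial.

Means. Both are sums over the points of edge probabilities, so dependence between edges is
irrelevant. Off a null set, an edge of length `d` is present with probability `exp (-lamE * π * d ^
2 / L)`, whatever its direction and the angle of its source (`IsPoissonProcess.measure_reaches`). By
Campbell's theorem either mean is `lamL` times the integral of this Gaussian. Each edge involves the
angle of its source only, hence the joint law of the angles plays no role. -/

/-! ### Geometry of the sectors -/

/-- The plane identified with the complex numbers. -/
noncomputable def planeToComplex : Plane ≃ₗᵢ[ℝ] ℂ := Complex.orthonormalBasisOneI.repr.symm

lemma planeToComplex_mk (a b : ℝ) : planeToComplex !₂[a, b] = a + b * Complex.I := by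
  simp [planeToComplex, Complex.orthonormalBasisOneI_repr_symm_apply]

/-- The direction of the bisector of a sector. -/
noncomputable def sectorAxis (L : ℕ) (φ : ℝ) (l : Fin L) : ℝ :=
  φ + ((l : ℝ) + 1 / 2) * (2 * Real.pi / L)

/-- The vector from `x` to `z` as a complex number, rotated such that the bisector of the sector
becomes the positive real axis. -/
noncomputable def sectorCoord (L : ℕ) (x : Plane) (φ : ℝ) (l : Fin L) (z : Plane) : ℂ :=
  Complex.exp (-(sectorAxis L φ l : ℂ) * Complex.I) * planeToComplex (z - x)

/-- Centring the sector at the positive real axis leaves a window of half-width `π / L ≤ π`, where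
the principal argument serves as the polar angle and no reduction modulo `2π` is needed. -/
lemma mem_sector_iff {L : ℕ} {x : Plane} {φ : ℝ} {l : Fin L} {z : Plane} :
    z ∈ sector L x φ l ↔ sectorCoord L x φ l z ≠ 0 ∧
      |(sectorCoord L x φ l z).arg| < Real.pi / L := by
  have hL : 1 ≤ (L : ℝ) := by exact_mod_cast (Nat.one_le_iff_ne_zero.2 (Fin.pos l).ne')
  have hπL : Real.pi / L ≤ Real.pi := div_le_self Real.pi_pos.le hL
  constructor
  · rintro ⟨r, θ, hr, h1, h2, rfl⟩
    have h : sectorCoord L x φ l (x + !₂[r * Real.cos θ, r * Real.sin θ])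
        = r * (Complex.cos (θ - sectorAxis L φ l : ℝ) +
          Complex.sin (θ - sectorAxis L φ l : ℝ) * Complex.I) := by
      rw [sectorCoord, add_sub_cancel_left, planeToComplex_mk, ← Complex.exp_mul_I]
      have : ((r * Real.cos θ : ℝ) : ℂ) + ((r * Real.sin θ : ℝ) : ℂ) * Complex.I
          = r * Complex.exp (θ * Complex.I) := by
        rw [Complex.exp_mul_I]; push_cast; ring
      rw [this, mul_left_comm, ← Complex.exp_add]
      congr 2; push_cast; ring
    have habs : |θ - sectorAxis L φ l| < Real.pi / L := by
      rw [abs_lt, sectorAxis]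
      have e : 2 * Real.pi / L = 2 * (Real.pi / L) := by ring
      rw [e] at h1 h2 ⊢
      constructor <;> linarith
    have hab := abs_lt.1 habs
    rw [h]
    refine ⟨mul_ne_zero (by exact_mod_cast hr.ne') ?_, ?_⟩
    · rw [← Complex.exp_mul_I]; exact Complex.exp_ne_zero _
    · rw [Complex.arg_mul_cos_add_sin_mul_I hr ⟨by linarith [hab.1], by linarith [hab.2]⟩]
      exact habs
  · rintro ⟨h0, harg⟩
    set w := sectorCoord L x φ l z with hw
    have hab := abs_lt.1 harg
    have e : 2 * Real.pi / L = 2 * (Real.pi / L) := by ring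
    refine ⟨‖w‖, w.arg + sectorAxis L φ l, norm_pos_iff.2 h0, ?_, ?_, ?_⟩
    · rw [sectorAxis, e]; linarith
    · rw [sectorAxis, e]; linarith
    · rw [← sub_eq_iff_eq_add']
      apply planeToComplex.injective
      rw [planeToComplex_mk]
      have h1 : planeToComplex (z - x) = Complex.exp ((sectorAxis L φ l : ℂ) * Complex.I) * w := by
        rw [hw, sectorCoord, ← mul_assoc, ← Complex.exp_add]; simp
      rw [h1]
      conv_lhs => rw [← Complex.norm_mul_exp_arg_mul_I w]
      rw [mul_left_comm, ← Complex.exp_add, ← add_mul, Complex.exp_mul_I]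
      push_cast
      ring_nf

lemma norm_sectorCoord (L : ℕ) (x : Plane) (φ : ℝ) (l : Fin L) (z : Plane) :
    ‖sectorCoord L x φ l z‖ = dist x z := by
  rw [sectorCoord, norm_mul, planeToComplex.norm_map, ← Complex.ofReal_neg,
    Complex.norm_exp_ofReal_mul_I, one_mul, dist_eq_norm, norm_sub_rev]

lemma sectorCoord_measurable (L : ℕ) (l : Fin L) :
    Measurable fun p : Plane × ℝ × Plane => sectorCoord L p.1 p.2.1 l p.2.2 := by
  have := planeToComplex.continuous
  unfold sectorCoord sectorAxis
  apply Continuous.measurable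
  fun_prop

lemma measurableSet_sector_prod (L : ℕ) (l : Fin L) :
    MeasurableSet {p : Plane × ℝ × Plane | p.2.2 ∈ sector L p.1 p.2.1 l} := by
  simp only [mem_sector_iff]
  have h := sectorCoord_measurable L l
  refine MeasurableSet.inter (h (measurableSet_singleton 0).compl) ?_
  exact measurableSet_lt (by simpa using (Complex.measurable_arg.comp h).norm) measurable_const

lemma measurableSet_sector (L : ℕ) (x : Plane) (φ : ℝ) (l : Fin L) :
    MeasurableSet (sector L x φ l) :=
  (measurable_const.prodMk (measurable_const.prodMk measurable_id) :
    Measurable fun z : Plane => (x, φ, z)) (measurableSet_sector_prod L l)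

/-- In polar coordinates the indicator splits into a radial and an angular factor, and the area is
`(r ^ 2 / 2) * (2 * a)`. -/
lemma volume_complex_sector_inter_ball {a r : ℝ} (haπ : a ≤ Real.pi) (hr : 0 ≤ r) :
    volume {w : ℂ | (w ≠ 0 ∧ |w.arg| < a) ∧ ‖w‖ < r} = ENNReal.ofReal (a * r ^ 2) := by
  have hm : MeasurableSet {w : ℂ | (w ≠ 0 ∧ |w.arg| < a) ∧ ‖w‖ < r} := by
    refine MeasurableSet.inter (MeasurableSet.inter (measurableSet_singleton 0).compl ?_) ?_
    · exact measurableSet_lt (by simpa using Complex.measurable_arg.norm) measurable_const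
    · exact measurableSet_lt measurable_norm measurable_const
  rw [← lintegral_indicator_one hm, ← Complex.lintegral_comp_polarCoord_symm,
    polarCoord_target]
  have h1 : ∀ p ∈ Set.Ioi (0 : ℝ) ×ˢ Set.Ioo (-Real.pi) Real.pi,
      ENNReal.ofReal p.1 • (({w : ℂ | (w ≠ 0 ∧ |w.arg| < a) ∧ ‖w‖ < r}.indicator 1
        (Complex.polarCoord.symm p) : ℝ≥0∞)) =
      (Set.Iio r).indicator (fun t => ENNReal.ofReal t) p.1 *
        (Set.Ioo (-a) a).indicator 1 p.2 := by
    rintro ⟨t, θ⟩ ⟨ht, hθ⟩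
    simp only [Set.mem_Ioi] at ht
    have harg : (Complex.polarCoord.symm (t, θ)).arg = θ := by
      rw [Complex.polarCoord_symm_apply]
      simpa using Complex.arg_mul_cos_add_sin_mul_I ht ⟨hθ.1, hθ.2.le⟩
    have hn : ‖Complex.polarCoord.symm (t, θ)‖ = t := by
      rw [Complex.norm_polarCoord_symm]; exact abs_of_pos ht
    have h0 : Complex.polarCoord.symm (t, θ) ≠ 0 := by
      rw [← norm_ne_zero_iff, hn]; exact ht.ne'
    generalize Complex.polarCoord.symm (t, θ) = w at *
    by_cases h1 : t < r <;> by_cases h2 : |θ| < a <;>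
      simp [Set.indicator, harg, hn, h0, h1, h2, ← abs_lt]
  rw [setLIntegral_congr_fun (measurableSet_Ioi.prod measurableSet_Ioo) h1,
    Measure.volume_eq_prod, ← Measure.prod_restrict]
  rw [lintegral_prod_mul (ENNReal.measurable_ofReal.indicator measurableSet_Iio).aemeasurable
    (measurable_one.indicator measurableSet_Ioo).aemeasurable,
    lintegral_indicator_one measurableSet_Ioo, Measure.restrict_apply measurableSet_Ioo,
    Set.inter_eq_left.2 (Set.Ioo_subset_Ioo (by linarith) haπ), Real.volume_Ioo,
    lintegral_indicator measurableSet_Iio, Measure.restrict_restrict measurableSet_Iio]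
  have h2 : Set.Iio r ∩ Set.Ioi 0 = Set.Ioo 0 r := by ext; simp [and_comm]
  have h3 : ∫⁻ t in Set.Ioo 0 r, ENNReal.ofReal t = ENNReal.ofReal (r ^ 2 / 2) := by
    rw [← ofReal_integral_eq_lintegral_ofReal]
    · rw [← integral_Ioc_eq_integral_Ioo, ← intervalIntegral.integral_of_le hr, integral_id]
      simp
    · exact (continuous_id.integrableOn_Icc).mono_set Set.Ioo_subset_Icc_self
    · exact (ae_restrict_iff' measurableSet_Ioo).2 (.of_forall fun t ht => ht.1.le)
  rw [h2, h3, ← ENNReal.ofReal_mul (by positivity)]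
  congr 1; ring

lemma sectorCoord_measurePreserving (L : ℕ) (x : Plane) (φ : ℝ) (l : Fin L) :
    MeasurePreserving (sectorCoord L x φ l) := by
  have h1 : MeasurePreserving (fun z : Plane => z - x) := measurePreserving_sub_right volume x
  have h3 := (rotation (Circle.exp (-sectorAxis L φ l))).measurePreserving
  have := h3.comp (planeToComplex.measurePreserving.comp h1)
  convert this using 1
  ext z
  rw [Function.comp_apply, rotation_apply, Circle.coe_exp, Complex.ofReal_neg]
  rfl

lemma volume_sector_inter_ball {L : ℕ} (x : Plane) (φ : ℝ) (l : Fin L) {r : ℝ} (hr : 0 ≤ r) :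
    volume (sector L x φ l ∩ Metric.ball x r) = ENNReal.ofReal (Real.pi / L * r ^ 2) := by
  have hL : 1 ≤ (L : ℝ) := by exact_mod_cast (Nat.one_le_iff_ne_zero.2 (Fin.pos l).ne')
  have hπL : Real.pi / L ≤ Real.pi := div_le_self Real.pi_pos.le hL
  have hm : MeasurableSet {w : ℂ | (w ≠ 0 ∧ |w.arg| < Real.pi / L) ∧ ‖w‖ < r} := by
    refine MeasurableSet.inter (MeasurableSet.inter (measurableSet_singleton 0).compl ?_) ?_
    · exact measurableSet_lt (by simpa using Complex.measurable_arg.norm) measurable_const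
    · exact measurableSet_lt measurable_norm measurable_const
  rw [← volume_complex_sector_inter_ball hπL hr,
    ← (sectorCoord_measurePreserving L x φ l).measure_preimage hm.nullMeasurableSet]
  congr 1
  ext z
  simp only [Set.mem_inter_iff, mem_sector_iff, Set.mem_preimage, Set.mem_ofPred_eq,
    norm_sectorCoord, Metric.mem_ball']

lemma volume_sector_inter_closedBall {L : ℕ} (x : Plane) (φ : ℝ) (l : Fin L) {r : ℝ}
    (hr : 0 ≤ r) :
    volume (sector L x φ l ∩ Metric.closedBall x r) = ENNReal.ofReal (Real.pi / L * r ^ 2) := by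
  rw [← volume_sector_inter_ball x φ l hr]
  refine measure_congr (.inter (.refl _ _) ?_)
  rw [← Metric.ball_union_sphere]
  exact union_ae_eq_left_of_ae_eq_empty (ae_eq_empty.2 (Measure.addHaar_sphere _ x r))

/-- A common point would have two polar angles differing by strictly between `0` and `2π`, although
the cosine of the difference is `1`. -/
lemma sector_disjoint {L : ℕ} (x : Plane) (φ : ℝ) {l m : Fin L} (h : l ≠ m) :
    Disjoint (sector L x φ l) (sector L x φ m) := by
  wlog hlm : l < m generalizing l m
  · exact (this h.symm (lt_of_le_of_ne (not_lt.1 hlm) h.symm)).symm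
  rw [Set.disjoint_left]
  rintro z ⟨r, θ, hr, h1, h2, rfl⟩ ⟨s, η, hs, h3, h4, h5⟩
  have hL : 0 < (L : ℝ) := by exact_mod_cast (Fin.pos l)
  have h6 : (l : ℝ) + 1 ≤ m := by exact_mod_cast hlm
  have h7 : (m : ℝ) + 1 ≤ L := by exact_mod_cast m.2
  have hc : 0 < 2 * Real.pi / L := by positivity
  have h8 : θ < η := by nlinarith
  have h9 : η - θ < 2 * Real.pi := by
    have e : 2 * Real.pi = L * (2 * Real.pi / L) := by field_simp
    rw [e]
    have : 0 ≤ (l : ℝ) := by positivity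
    nlinarith
  have h10 := add_left_cancel h5
  have hre : r * Real.cos θ = s * Real.cos η := by simpa using congrArg (fun z : Plane => z 0) h10
  have him : r * Real.sin θ = s * Real.sin η := by simpa using congrArg (fun z : Plane => z 1) h10
  have hrs : r = s := by
    have : r ^ 2 = s ^ 2 := by
      calc r ^ 2 = (r * Real.cos θ) ^ 2 + (r * Real.sin θ) ^ 2 := by
            linear_combination (-r ^ 2) * Real.sin_sq_add_cos_sq θ
        _ = (s * Real.cos η) ^ 2 + (s * Real.sin η) ^ 2 := by rw [hre, him]
        _ = s ^ 2 := by linear_combination (s ^ 2) * Real.sin_sq_add_cos_sq η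
    exact (sq_eq_sq₀ hr.le hs.le).1 this
  subst hrs
  have hcos := mul_left_cancel₀ hr.ne' hre
  have hsin := mul_left_cancel₀ hr.ne' him
  have hone : Real.cos (η - θ) = 1 := by
    rw [Real.cos_sub, ← hcos, ← hsin]
    linear_combination Real.sin_sq_add_cos_sq θ
  rw [Real.cos_eq_one_iff_of_lt_of_lt (by linarith [Real.pi_pos]) h9] at hone
  linarith

/-- In every disc around `x` the `L` disjoint sectors have total area equal to that of the disc, so
what they miss is null. -/
lemma ae_mem_sector {L : ℕ} (hL : 1 ≤ L) (x : Plane) (φ : ℝ) :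
    ∀ᵐ z, ∃ l, z ∈ sector L x φ l := by
  have hL' : (L : ℝ) ≠ 0 := by positivity
  have hm : MeasurableSet (⋃ l, sector L x φ l) :=
    MeasurableSet.iUnion fun l => measurableSet_sector L x φ l
  have h : ∀ n : ℕ, volume (Metric.ball x n \ ⋃ l, sector L x φ l) = 0 := by
    intro n
    have h1 : volume ((⋃ l, sector L x φ l) ∩ Metric.ball x n) = volume (Metric.ball x (n : ℝ)) := by
      rw [Set.iUnion_inter, measure_iUnion
        (fun l m hlm => (sector_disjoint x φ hlm).mono Set.inter_subset_left Set.inter_subset_left)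
        (fun l => (measurableSet_sector L x φ l).inter measurableSet_ball), tsum_fintype]
      simp only [volume_sector_inter_ball x φ _ (Nat.cast_nonneg n), Finset.sum_const,
        Finset.card_univ, Fintype.card_fin, nsmul_eq_mul]
      rw [EuclideanSpace.volume_ball_fin_two, ← ENNReal.ofReal_natCast,
        ← ENNReal.ofReal_mul (by positivity)]
      have e : (L : ℝ) * (Real.pi / L * (n : ℝ) ^ 2) = (n : ℝ) ^ 2 * Real.pi := by
        field_simp
      rw [e, ENNReal.ofReal_mul (by positivity), ENNReal.ofReal_pow (by positivity)]
    rw [← Set.sdiff_self_inter, Set.inter_comm, measure_sdiff Set.inter_subset_right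
      (hm.inter measurableSet_ball).nullMeasurableSet, h1, tsub_self]
    rw [h1]
    exact measure_ball_lt_top.ne
  rw [ae_iff]
  refine measure_mono_null ?_ (measure_iUnion_null h)
  intro z hz
  obtain ⟨n, hn⟩ := exists_nat_gt (dist z x)
  exact Set.mem_iUnion.2 ⟨n, hn, by simpa using hz⟩

/-- Membership depends on the difference `z - x` only. -/
lemma neg_mem_sector_reflect {L : ℕ} {x : Plane} {φ : ℝ} {l : Fin L} :
    (0 : Plane) ∈ sector L x φ l ↔ -x ∈ sector L 0 φ l := by
  rw [mem_sector_iff, mem_sector_iff]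
  simp [sectorCoord]

lemma ae_zero_mem_sector {L : ℕ} (hL : 1 ≤ L) (φ : ℝ) :
    ∀ᵐ x, ∃ l, (0 : Plane) ∈ sector L x φ l := by
  simp only [neg_mem_sector_reflect]
  exact (Measure.measurePreserving_neg (volume : Measure Plane)).quasiMeasurePreserving.ae
    (ae_mem_sector hL 0 φ)

/-! ### Counting random indices -/

lemma measurable_encard_setOf {α ι : Type*} [MeasurableSpace α] [Countable ι] {p : ι → α → Prop}
    (h : ∀ i, MeasurableSet {a | p i a}) : Measurable fun a => {i | p i a}.encard :=
  measurable_encard.comp (measurable_set_iff.2 fun i => measurableSet_setOfPred.1 (h i))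

lemma lintegral_encard_setOf {α ι : Type*} [MeasurableSpace α] [Countable ι] (μ : Measure α)
    {p : ι → α → Prop} (h : ∀ i, MeasurableSet {a | p i a}) :
    ∫⁻ a, ({i | p i a}.encard : ℝ≥0∞) ∂μ = ∑' i, μ {a | p i a} := by
  classical
  have h1 : ∀ a, ({i | p i a}.encard : ℝ≥0∞) = ∑' i, {a | p i a}.indicator 1 a := by
    intro a
    let _ : MeasurableSpace ι := ⊤
    rw [← Measure.count_apply (show MeasurableSet {i | p i a} from trivial),
      ← lintegral_indicator_one (show MeasurableSet {i | p i a} from trivial), lintegral_count]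
    rfl
  simp only [h1]
  rw [lintegral_tsum fun i => (measurable_one.indicator (h i)).aemeasurable]
  exact tsum_congr fun i => lintegral_indicator_one (h i)

/-! ### Poisson weights -/

/-- The probability that a Poisson variable of mean `a` equals `n`. -/
noncomputable def poissonProb (a : ℝ) (n : ℕ) : ℝ := Real.exp (-a) * a ^ n / n.factorial

lemma poissonProb_nonneg {a : ℝ} (ha : 0 ≤ a) (n : ℕ) : 0 ≤ poissonProb a n := by
  unfold poissonProb; positivity

lemma tsum_ofReal_poissonProb {a : ℝ} (ha : 0 ≤ a) :
    ∑' n, ENNReal.ofReal (poissonProb a n) = 1 := by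
  have h := hasSum_one_poissonMeasure ⟨a, ha⟩
  rw [← ENNReal.ofReal_tsum_of_nonneg (poissonProb_nonneg ha) h.summable]
  exact (congrArg ENNReal.ofReal h.tsum_eq).trans ENNReal.ofReal_one

/-- The identity `(n + 1) * p (n + 1) = a * p n` reduces the mean to the total mass. -/
lemma tsum_mul_ofReal_poissonProb {a : ℝ} (ha : 0 ≤ a) :
    ∑' n : ℕ, (n : ℝ≥0∞) * ENNReal.ofReal (poissonProb a n) = ENNReal.ofReal a := by
  rw [tsum_eq_zero_add' ENNReal.summable]
  have h : ∀ n : ℕ, ((n + 1 : ℕ) : ℝ≥0∞) * ENNReal.ofReal (poissonProb a (n + 1)) =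
      ENNReal.ofReal a * ENNReal.ofReal (poissonProb a n) := by
    intro n
    rw [← ENNReal.ofReal_natCast, ← ENNReal.ofReal_mul (by positivity), ← ENNReal.ofReal_mul ha]
    congr 1
    simp only [poissonProb, Nat.factorial_succ]
    push_cast
    field_simp
    ring
  simp only [h, ENNReal.tsum_mul_left, tsum_ofReal_poissonProb ha]
  simp

/-! ### Void probabilities and Campbell's theorem -/

namespace IsPoissonProcess

variable {Ω : Type*} [MeasurableSpace Ω] {μ : Measure Ω} {X : ℕ → Ω → Plane} {lam : ℝ}

lemma measurable_pointCount (hX : IsPoissonProcess μ X lam) {B : Set Plane}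
    (hB : MeasurableSet B) : Measurable (pointCount X B) :=
  measurable_encard_setOf fun i => hX.measurable i hB

lemma void_prob (hX : IsPoissonProcess μ X lam) {B : Set Plane} (hB : MeasurableSet B)
    (hv : volume B ≠ ∞) :
    μ {ω | ∀ k, X k ω ∉ B} = ENNReal.ofReal (Real.exp (-(lam * volume.real B))) := by
  have h := hX.count_law B hB hv 0
  simpa [pointCount, Set.eq_empty_iff_forall_notMem] using h

lemma tsum_measure_preimage [IsProbabilityMeasure μ] (hX : IsPoissonProcess μ X lam)
    (hlam : 0 ≤ lam) {B : Set Plane} (hB : MeasurableSet B) (hv : volume B ≠ ∞) :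
    ∑' i, μ (X i ⁻¹' B) = ENNReal.ofReal lam * volume B := by
  have hm := hX.measurable_pointCount hB
  have ha : 0 ≤ lam * volume.real B := by positivity
  have hms : ∀ n : ℕ, MeasurableSet {ω | pointCount X B ω = n} := fun n =>
    hm (measurableSet_singleton _)
  -- The Poisson weights already sum to `1`, so no mass is left for the value `∞` of the count.
  have hfin : ∀ᵐ ω ∂μ, ∃ n : ℕ, pointCount X B ω = n := by
    have h1 : μ (⋃ n : ℕ, {ω | pointCount X B ω = n}) = 1 := by
      rw [measure_iUnion _ hms]
      · simp only [hX.count_law B hB hv]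
        exact tsum_ofReal_poissonProb ha
      · intro n m hnm
        refine Set.disjoint_left.2 fun ω h2 h3 => hnm ?_
        have h4 : (n : ℕ∞) = m := h2.symm.trans h3
        exact_mod_cast h4
    have h2 := (mem_ae_iff_prob_eq_one (MeasurableSet.iUnion hms)).2 h1
    filter_upwards [h2] with ω hω using by simpa using hω
  have h1 : ∫⁻ ω, (pointCount X B ω : ℝ≥0∞) ∂μ = ∑' i, μ (X i ⁻¹' B) :=
    lintegral_encard_setOf μ fun i => hX.measurable i hB
  have h2 : ∀ᵐ ω ∂μ, (pointCount X B ω : ℝ≥0∞) =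
      ∑' n : ℕ, {ω | pointCount X B ω = n}.indicator (fun _ => (n : ℝ≥0∞)) ω := by
    filter_upwards [hfin] with ω hω
    obtain ⟨n, hn⟩ := hω
    rw [tsum_eq_single n]
    · simp [hn]
    · intro m hmn
      refine Set.indicator_of_notMem (fun h => hmn ?_) _
      have h4 : (m : ℕ∞) = n := h.symm.trans hn
      exact_mod_cast h4
  rw [← h1, lintegral_congr_ae h2,
    lintegral_tsum fun n => (measurable_const.indicator (hms n)).aemeasurable]
  simp only [lintegral_indicator_const (hms _), hX.count_law B hB hv]
  refine (tsum_mul_ofReal_poissonProb ha).trans ?_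
  rw [ENNReal.ofReal_mul hlam, ofReal_measureReal hv]

/-- Campbell's theorem: the intensity measure of a homogeneous Poisson process. -/
lemma sum_map [IsProbabilityMeasure μ] (hX : IsPoissonProcess μ X lam) (hlam : 0 ≤ lam) :
    Measure.sum (fun i => μ.map (X i)) = ENNReal.ofReal lam • (volume : Measure Plane) := by
  ext s hs
  -- The count law speaks of sets of finite area only, so `s` is exhausted by such sets.
  have h1 : s = ⋃ n, s ∩ spanningSets (volume : Measure Plane) n := by
    rw [← Set.inter_iUnion, iUnion_spanningSets, Set.inter_univ]
  have hmono : Monotone fun n => s ∩ spanningSets (volume : Measure Plane) n := fun n m hnm =>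
    Set.inter_subset_inter_right _ (monotone_spanningSets _ hnm)
  rw [h1, hmono.measure_iUnion, hmono.measure_iUnion]
  congr 1
  ext n
  have hm := hs.inter (measurableSet_spanningSets (volume : Measure Plane) n)
  rw [Measure.sum_apply _ hm, Measure.smul_apply, smul_eq_mul,
    ← hX.tsum_measure_preimage hlam hm
      (measure_ne_top_of_subset Set.inter_subset_right (measure_spanningSets_lt_top _ n).ne)]
  exact tsum_congr fun i => Measure.map_apply (hX.measurable i) hm

lemma tsum_lintegral [IsProbabilityMeasure μ] (hX : IsPoissonProcess μ X lam) (hlam : 0 ≤ lam)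
    (f : Plane → ℝ≥0∞) :
    ∑' i, ∫⁻ x, f x ∂(μ.map (X i)) = ENNReal.ofReal lam * ∫⁻ x, f x := by
  rw [← lintegral_sum_measure, hX.sum_map hlam, lintegral_smul_measure, smul_eq_mul]

/-- Each point has a law bounded by the intensity measure. This permits discarding the sector
boundaries, which are Lebesgue null. -/
lemma map_absolutelyContinuous [IsProbabilityMeasure μ] (hX : IsPoissonProcess μ X lam)
    (hlam : 0 ≤ lam) (i : ℕ) : μ.map (X i) ≪ volume :=
  (Measure.absolutelyContinuous_sum_right i .rfl).trans
    (hX.sum_map hlam ▸ Measure.smul_absolutelyContinuous)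

end IsPoissonProcess

/-! ### Reachable sets and degrees -/

/-- A node at `x` with offset angle `φ` reaches the point `y` in the presence of the
eavesdroppers `e`. -/
def Reaches (L : ℕ) (x : Plane) (φ : ℝ) (e : ℕ → Plane) (y : Plane) : Prop :=
  ∃ l : Fin L, y ∈ sector L x φ l ∧ ∀ k, e k ∈ sector L x φ l → dist x y < dist x (e k)

/-- The part of a sector closer to the apex than every eavesdropper in the sector. -/
def clearSector (L : ℕ) (x : Plane) (φ : ℝ) (e : ℕ → Plane) (l : Fin L) : Set Plane :=
  {y | y ∈ sector L x φ l ∧ ∀ k, e k ∈ sector L x φ l → dist x y < dist x (e k)}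

lemma setOf_reaches (L : ℕ) (x : Plane) (φ : ℝ) (e : ℕ → Plane) :
    {y | Reaches L x φ e y} = ⋃ l, clearSector L x φ e l := by
  ext y; simp [Reaches, clearSector]

lemma Measurable.mem_sector {α : Type*} [MeasurableSpace α] {L : ℕ} {x y : α → Plane} {φ : α → ℝ}
    (hx : Measurable x) (hφ : Measurable φ) (hy : Measurable y) (l : Fin L) :
    MeasurableSet {a | y a ∈ sector L (x a) (φ a) l} :=
  (hx.prodMk (hφ.prodMk hy)) (measurableSet_sector_prod L l)

lemma Measurable.mem_clearSector {α : Type*} [MeasurableSpace α] {L : ℕ} {x y : α → Plane}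
    {φ : α → ℝ} {e : α → ℕ → Plane} (hx : Measurable x) (hφ : Measurable φ) (he : Measurable e)
    (hy : Measurable y) (l : Fin L) :
    MeasurableSet {a | y a ∈ clearSector L (x a) (φ a) (e a) l} := by
  have hek : ∀ k, Measurable fun a => e a k := fun k => (measurable_pi_apply k).comp he
  have : {a | y a ∈ clearSector L (x a) (φ a) (e a) l} = {a | y a ∈ sector L (x a) (φ a) l} ∩
      ⋂ k, ({a | e a k ∈ sector L (x a) (φ a) l}ᶜ ∪
        {a | Dist.dist (x a) (y a) < Dist.dist (x a) (e a k)}) := by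
    ext a
    simp [clearSector, imp_iff_not_or]
  rw [this]
  exact (hx.mem_sector hφ hy l).inter (.iInter fun k => (hx.mem_sector hφ (hek k) l).compl.union
    (measurableSet_lt (hx.dist hy) (hx.dist (hek k))))

lemma Measurable.reaches {α : Type*} [MeasurableSpace α] {L : ℕ} {x y : α → Plane} {φ : α → ℝ}
    {e : α → ℕ → Plane} (hx : Measurable x) (hφ : Measurable φ) (he : Measurable e)
    (hy : Measurable y) : MeasurableSet {a | Reaches L (x a) (φ a) (e a) (y a)} := by
  have : {a | Reaches L (x a) (φ a) (e a) (y a)} =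
      ⋃ l, {a | y a ∈ clearSector L (x a) (φ a) (e a) l} := by
    ext a; simp [Reaches, clearSector]
  rw [this]
  exact .iUnion fun l => hx.mem_clearSector hφ he hy l

lemma volume_setOf_reaches (L : ℕ) (x : Plane) (φ : ℝ) (e : ℕ → Plane) :
    volume {y | Reaches L x φ e y} = ∑ l, volume (clearSector L x φ e l) := by
  rw [setOf_reaches, measure_iUnion, tsum_fintype]
  · exact fun l m hlm => (sector_disjoint x φ hlm).mono (fun _ h => h.1) (fun _ h => h.1)
  · exact fun l => measurable_const.mem_clearSector (α := Plane) measurable_const measurable_const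
      measurable_id l

section Graph

variable {Ω : Type*} {L : ℕ} {X E : ℕ → Ω → Plane} {Φ : ℕ → Ω → ℝ} {ω : Ω}

lemma not_typicalGraph_adj_self (i : ℕ) : ¬ (typicalGraph L X E Φ ω).Adj i i := by
  rintro ⟨l, h, -⟩
  have h0 := (mem_sector_iff.1 h).1
  rw [← norm_ne_zero_iff, norm_sectorCoord, dist_self] at h0
  exact h0 rfl

/-- Since the typical node is not adjacent to itself, its degrees count points of the process alone.
-/
lemma Set.encard_setOf_nat_eq {p : ℕ → Prop} (h : ¬ p 0) :
    {i | p i}.encard = {i | p (i + 1)}.encard := by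
  have : {i | p i} = Nat.succ '' {i | p (i + 1)} := by
    ext i
    cases i <;> simp [h]
  rw [this, Nat.succ_injective.encard_image]

lemma outDegree_typicalGraph : outDegree (typicalGraph L X E Φ ω) 0 =
    {i | Reaches L 0 (Φ 0 ω) (fun k => E k ω) (X i ω)}.encard :=
  Set.encard_setOf_nat_eq (not_typicalGraph_adj_self 0)

lemma inDegree_typicalGraph : inDegree (typicalGraph L X E Φ ω) 0 =
    {i | Reaches L (X i ω) (Φ (i + 1) ω) (fun k => E k ω) 0}.encard :=
  Set.encard_setOf_nat_eq (p := fun i => (typicalGraph L X E Φ ω).Adj i 0)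
    (not_typicalGraph_adj_self 0)

end Graph

/-! ### Mean degrees -/

/-- The probability of an edge between nodes at distance `d`. -/
noncomputable def edgeProb (L : ℕ) (lamE d : ℝ) : ℝ :=
  Real.exp (-(lamE * (Real.pi / L * d ^ 2)))

lemma IsPoissonProcess.measure_reaches {Ω : Type*} [MeasurableSpace Ω] {μ : Measure Ω}
    {E : ℕ → Ω → Plane} {lamE : ℝ} (hE : IsPoissonProcess μ E lamE) {L : ℕ} {x y : Plane} {φ : ℝ}
    (h : ∃ l, y ∈ sector L x φ l) :
    μ {ω | Reaches L x φ (fun k => E k ω) y} = ENNReal.ofReal (edgeProb L lamE (dist x y)) := by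
  obtain ⟨l, hl⟩ := h
  have hv := volume_sector_inter_closedBall (L := L) x φ l (r := dist x y) dist_nonneg
  -- The ball is closed because an eavesdropper at distance exactly `dist x y` blocks the edge.
  have h1 : {ω | Reaches L x φ (fun k => E k ω) y} =
      {ω | ∀ k, E k ω ∉ sector L x φ l ∩ Metric.closedBall x (dist x y)} := by
    ext ω
    constructor
    · rintro ⟨m, hm, h2⟩ k ⟨h3, h4⟩
      obtain rfl : l = m := by
        by_contra hlm
        exact Set.disjoint_left.1 (sector_disjoint x φ hlm) hl hm
      exact not_le.2 (h2 k h3) (Metric.mem_closedBall'.1 h4)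
    · intro h2
      exact ⟨l, hl, fun k hk => not_le.1 fun h3 => h2 k ⟨hk, Metric.mem_closedBall'.2 h3⟩⟩
  have hv' : volume.real (sector L x φ l ∩ Metric.closedBall x (dist x y)) =
      Real.pi / L * dist x y ^ 2 := by
    rw [measureReal_def, hv, ENNReal.toReal_ofReal (by positivity)]
  rw [h1, hE.void_prob ((measurableSet_sector L x φ l).inter measurableSet_closedBall)
    (by rw [hv]; exact ENNReal.ofReal_ne_top), hv']
  rfl

lemma lintegral_edgeProb {L : ℕ} (hL : 1 ≤ L) {lamE : ℝ} (hlamE : 0 < lamE) :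
    ∫⁻ x : Plane, ENNReal.ofReal (edgeProb L lamE ‖x‖) = ENNReal.ofReal (L / lamE) := by
  have hL' : (0 : ℝ) < L := by exact_mod_cast hL
  have h := GaussianFourier.integral_rexp_neg_mul_sq_norm (V := Plane)
    (b := lamE * (Real.pi / L)) (by positivity)
  have h1 : ∫ x : Plane, edgeProb L lamE ‖x‖ = L / lamE := by
    have e : (fun x : Plane => edgeProb L lamE ‖x‖) =
        fun x => Real.exp (-(lamE * (Real.pi / L)) * ‖x‖ ^ 2) := by
      ext x; rw [edgeProb]; ring_nf
    rw [e, h, finrank_euclideanSpace_fin]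
    have := Real.pi_pos.ne'
    norm_num
    field_simp
  rw [← ofReal_integral_eq_lintegral_ofReal, h1]
  -- A non-integrable function has Bochner integral `0`, so the nonzero value just found yields
  -- integrability.
  · exact .of_integral_ne_zero (by rw [h1]; positivity)
  · exact .of_forall fun x => (Real.exp_pos _).le

section Mean

variable {Ω : Type*} [MeasurableSpace Ω] {μ : Measure Ω} [IsProbabilityMeasure μ]
  {X E : ℕ → Ω → Plane} {lamL lamE : ℝ}

/-- The maps `s` and `t` give source and target of the edge as functions of the random point; one of
them is constantly `0`, which covers both degrees. By independence, point and angle can be frozen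
before the eavesdroppers are averaged. -/
lemma measure_reaches_eq_lintegral (hX : IsPoissonProcess μ X lamL) (hlamL : 0 ≤ lamL)
    (hE : IsPoissonProcess μ E lamE) (hXE : IndepFun (fun ω i => X i ω) (fun ω k => E k ω) μ)
    {ψ : Ω → ℝ} (hψ : Measurable ψ)
    (hXEψ : IndepFun (fun ω => ((fun i => X i ω), (fun k => E k ω))) ψ μ)
    {L : ℕ} {s t : Plane → Plane} (hs : Measurable s) (ht : Measurable t)
    (hst : ∀ x, dist (s x) (t x) = ‖x‖) (hsec : ∀ φ, ∀ᵐ x, ∃ l, t x ∈ sector L (s x) φ l)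
    (i : ℕ) :
    μ {ω | Reaches L (s (X i ω)) (ψ ω) (fun k => E k ω) (t (X i ω))} =
      ∫⁻ x, ENNReal.ofReal (edgeProb L lamE ‖x‖) ∂(μ.map (X i)) := by
  have hEm : Measurable fun ω k => E k ω := measurable_pi_lambda _ hE.measurable
  have hXi := hX.measurable i
  have hpr : Measurable fun p : (ℕ → Plane) × (ℕ → Plane) => (p.1 i, p.2) :=
    ((measurable_pi_apply i).comp measurable_fst).prodMk measurable_snd
  have h1 : IndepFun (X i) (fun ω k => E k ω) μ := hXE.comp (measurable_pi_apply i) measurable_id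
  have h2 : IndepFun (fun ω => (X i ω, fun k => E k ω)) ψ μ := hXEψ.comp hpr measurable_id
  have h3 := (indepFun_iff_map_prod_eq_prod_map_map hXi.aemeasurable hEm.aemeasurable).1 h1
  have h4 := (indepFun_iff_map_prod_eq_prod_map_map (hXi.prodMk hEm).aemeasurable
    hψ.aemeasurable).1 h2
  rw [h3] at h4
  set PX := μ.map (X i)
  set PE := μ.map (fun ω k => E k ω)
  set Pψ := μ.map ψ
  have : IsProbabilityMeasure PX := Measure.isProbabilityMeasure_map hXi.aemeasurable
  have : IsProbabilityMeasure PE := Measure.isProbabilityMeasure_map hEm.aemeasurable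
  have : IsProbabilityMeasure Pψ := Measure.isProbabilityMeasure_map hψ.aemeasurable
  let A : Set ((Plane × (ℕ → Plane)) × ℝ) := {p | Reaches L (s p.1.1) p.2 p.1.2 (t p.1.1)}
  have hA : MeasurableSet A := (hs.comp (measurable_fst.comp measurable_fst)).reaches
    measurable_snd (measurable_snd.comp measurable_fst)
    (ht.comp (measurable_fst.comp measurable_fst))
  have h5 : μ {ω | Reaches L (s (X i ω)) (ψ ω) (fun k => E k ω) (t (X i ω))} =
      ((PX.prod PE).prod Pψ) A := by
    rw [← h4, Measure.map_apply ((hXi.prodMk hEm).prodMk hψ) hA]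
    rfl
  rw [h5, Measure.prod_apply_symm hA]
  have h6 : ∀ φ, (PX.prod PE) ((fun p => (p, φ)) ⁻¹' A) =
      ∫⁻ x, ENNReal.ofReal (edgeProb L lamE ‖x‖) ∂PX := by
    intro φ
    rw [Measure.prod_apply (measurable_prodMk_right hA)]
    refine lintegral_congr_ae ?_
    filter_upwards [(hX.map_absolutelyContinuous hlamL i).ae_le (hsec φ)] with x hx
    rw [← hst x, ← hE.measure_reaches hx, Measure.map_apply hEm
      (measurable_prodMk_left (measurable_prodMk_right hA))]
    rfl
  simp only [h6, lintegral_const, measure_univ, mul_one]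

lemma tsum_measure_reaches (hX : IsPoissonProcess μ X lamL) (hlamL : 0 ≤ lamL)
    (hE : IsPoissonProcess μ E lamE) (hlamE : 0 < lamE)
    (hXE : IndepFun (fun ω i => X i ω) (fun ω k => E k ω) μ)
    {ψ : ℕ → Ω → ℝ} (hψ : ∀ i, Measurable (ψ i))
    (hXEψ : ∀ i, IndepFun (fun ω => ((fun i => X i ω), (fun k => E k ω))) (ψ i) μ)
    {L : ℕ} (hL : 1 ≤ L) {s t : Plane → Plane} (hs : Measurable s) (ht : Measurable t)
    (hst : ∀ x, dist (s x) (t x) = ‖x‖) (hsec : ∀ φ, ∀ᵐ x, ∃ l, t x ∈ sector L (s x) φ l) :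
    ∑' i, μ {ω | Reaches L (s (X i ω)) (ψ i ω) (fun k => E k ω) (t (X i ω))} =
      ENNReal.ofReal (L * lamL / lamE) := by
  simp only [measure_reaches_eq_lintegral hX hlamL hE hXE (hψ _) (hXEψ _) hs ht hst hsec]
  rw [hX.tsum_lintegral hlamL, lintegral_edgeProb hL hlamE, ← ENNReal.ofReal_mul hlamL]
  congr 1; ring

end Mean

/-! ### Splitting a Poisson count among the sectors -/

/-- The multinomial theorem: a Poisson variable is a sum of independent ones. -/
lemma poissonProb_sum {ι : Type*} [Fintype ι] [DecidableEq ι] (a : ι → ℝ) (n : ℕ) :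
    poissonProb (∑ i, a i) n =
      ∑ k ∈ Finset.univ.piAntidiag n, ∏ i, poissonProb (a i) (k i) := by
  rw [poissonProb, Finset.sum_pow_eq_sum_piAntidiag, Finset.mul_sum, Finset.sum_div]
  refine Finset.sum_congr rfl fun k hk => ?_
  have hn : ∑ i, k i = n := (Finset.mem_piAntidiag.1 hk).1
  have hspec : ((∏ i, (k i).factorial : ℕ) : ℝ) * (Nat.multinomial Finset.univ k : ℝ) =
      (n.factorial : ℝ) := by
    rw [← hn]
    exact_mod_cast Nat.multinomial_spec Finset.univ k
  simp only [poissonProb, Finset.prod_div_distrib, Finset.prod_mul_distrib, ← Real.exp_sum,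
    Finset.sum_neg_distrib]
  rw [← Nat.cast_prod]
  have h1 : (n.factorial : ℝ) ≠ 0 := by positivity
  have h2 : ((∏ i, (k i).factorial : ℕ) : ℝ) ≠ 0 := by positivity
  rw [div_eq_div_iff h1 h2, ← hspec]
  ring

/-- Stars and bars, the source of the binomial coefficient. -/
lemma card_piAntidiag_fin {L : ℕ} (hL : 1 ≤ L) (n : ℕ) :
    ((Finset.univ : Finset (Fin L)).piAntidiag n).card = (L + n - 1).choose (L - 1) := by
  rw [← Finset.map_sym_eq_piAntidiag, Finset.card_map, Finset.sym_univ, Finset.card_univ,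
    Sym.card_sym_eq_choose, Fintype.card_fin]
  exact Nat.choose_symm_of_eq_add (by omega)

/-! ### Exponential mixtures of Poisson laws -/

/-- The exponential distribution of rate `r`, as a measure on the extended nonnegative reals. -/
noncomputable def expLaw (r : ℝ) : Measure ℝ≥0∞ :=
  ((volume.restrict (Set.Ioi 0)).withDensity fun t => ENNReal.ofReal (r * Real.exp (-(r * t)))).map
    ENNReal.ofReal

lemma lintegral_exp_neg_Ioi {r : ℝ} (hr : 0 < r) (c : ℝ) :
    ∫⁻ t in Set.Ioi c, ENNReal.ofReal (r * Real.exp (-(r * t))) =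
      ENNReal.ofReal (Real.exp (-(r * c))) := by
  have h1 := integral_exp_mul_Ioi (neg_lt_zero.2 hr) c
  have h2 := integrableOn_exp_mul_Ioi (neg_lt_zero.2 hr) c
  simp only [neg_mul] at h1 h2
  rw [← ofReal_integral_eq_lintegral_ofReal (h2.const_mul r)
    (.of_forall fun t => by positivity), integral_const_mul, h1]
  congr 1
  field_simp

lemma measurable_expDensity (r : ℝ) :
    Measurable fun t : ℝ => ENNReal.ofReal (r * Real.exp (-(r * t))) := by fun_prop

lemma expLaw_Ici_ofReal {r : ℝ} (hr : 0 < r) {v : ℝ} (hv : 0 ≤ v) :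
    expLaw r (Set.Ici (ENNReal.ofReal v)) = ENNReal.ofReal (Real.exp (-(r * v))) := by
  have hm : MeasurableSet (ENNReal.ofReal ⁻¹' Set.Ici (ENNReal.ofReal v)) :=
    ENNReal.measurable_ofReal measurableSet_Ici
  rw [expLaw, Measure.map_apply ENNReal.measurable_ofReal measurableSet_Ici,
    withDensity_apply _ hm, Measure.restrict_restrict hm, ← lintegral_exp_neg_Ioi hr v]
  refine setLIntegral_congr ?_
  have h1 : ENNReal.ofReal ⁻¹' Set.Ici (ENNReal.ofReal v) ∩ Set.Ioi 0 = Set.Ici v ∩ Set.Ioi 0 := by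
    ext t
    simp only [Set.mem_inter_iff, Set.mem_preimage, Set.mem_Ici, Set.mem_Ioi, and_congr_left_iff]
    intro ht
    exact ENNReal.ofReal_le_ofReal_iff ht.le
  have h2 : Set.Ioi v ∩ Set.Ioi 0 = Set.Ioi v :=
    Set.inter_eq_left.2 (Set.Ioi_subset_Ioi hv)
  rw [h1]
  conv_rhs => rw [← h2]
  exact (Ioi_ae_eq_Ici.symm).inter (.refl _ _)

lemma expLaw_Ici_top (r : ℝ) : expLaw r (Set.Ici ∞) = 0 := by
  rw [expLaw, Measure.map_apply ENNReal.measurable_ofReal measurableSet_Ici]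
  have : ENNReal.ofReal ⁻¹' Set.Ici ∞ = ∅ := by ext; simp
  rw [this, measure_empty]

/-- A Gamma integral: mixing Poisson laws over an exponential mean gives a geometric law. -/
lemma lintegral_poissonProb_expLaw {r s : ℝ} (hr : 0 < r) (hs : 0 < s) (k : ℕ) :
    ∫⁻ v, ENNReal.ofReal (poissonProb (s * v.toReal) k) ∂(expLaw r) =
      ENNReal.ofReal ((s / (s + r)) ^ k * (r / (s + r))) := by
  have hm : Measurable fun v : ℝ≥0∞ => ENNReal.ofReal (poissonProb (s * v.toReal) k) := by
    unfold poissonProb; fun_prop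
  have h1 := Real.integral_rpow_mul_exp_neg_mul_Ioi (a := k + 1) (r := s + r) (by positivity)
    (by positivity)
  have e : ∀ t ∈ Set.Ioi (0 : ℝ), r * Real.exp (-(r * t)) * poissonProb (s * t) k =
      r * s ^ k / k.factorial * (t ^ ((k : ℝ) + 1 - 1) * Real.exp (-((s + r) * t))) := by
    intro t ht
    have h2 : -((s + r) * t) = -(r * t) + -(s * t) := by ring
    rw [add_sub_cancel_right, Real.rpow_natCast, h2, Real.exp_add, poissonProb]
    ring
  have h3 : ∫ t in Set.Ioi (0 : ℝ), r * Real.exp (-(r * t)) * poissonProb (s * t) k =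
      (s / (s + r)) ^ k * (r / (s + r)) := by
    rw [setIntegral_congr_fun measurableSet_Ioi e, integral_const_mul, h1,
      Real.Gamma_nat_eq_factorial]
    have h4 : (1 / (s + r)) ^ ((k : ℝ) + 1) = (1 / (s + r)) ^ (k + 1) := by
      exact_mod_cast Real.rpow_natCast (1 / (s + r)) (k + 1)
    rw [h4, div_pow, div_pow, one_pow, pow_succ]
    have : (k.factorial : ℝ) ≠ 0 := by positivity
    field_simp
  rw [expLaw, lintegral_map hm ENNReal.measurable_ofReal,
    lintegral_withDensity_eq_lintegral_mul _ (measurable_expDensity r)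
      (g := fun t => ENNReal.ofReal (poissonProb (s * (ENNReal.ofReal t).toReal) k))
      (hm.comp ENNReal.measurable_ofReal), ← h3]
  rw [ofReal_integral_eq_lintegral_ofReal]
  · refine setLIntegral_congr_fun measurableSet_Ioi fun t ht => ?_
    rw [Pi.mul_apply, ENNReal.toReal_ofReal (le_of_lt ht), ← ENNReal.ofReal_mul (by positivity)]
  · exact .of_integral_ne_zero (by rw [h3]; positivity)
  · refine (ae_restrict_iff' measurableSet_Ioi).2 (.of_forall fun t ht => ?_)
    have ht : 0 < t := ht
    exact mul_nonneg (by positivity) (poissonProb_nonneg (by positivity) k)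

/-! ### Law of the clear areas -/

/-- The radius at which a sector has area `v`. -/
noncomputable def sectorRadius (L : ℕ) (v : ℝ) : ℝ := √(v * L / Real.pi)

lemma volume_sector_inter_ball_sectorRadius {L : ℕ} (x : Plane) (φ : ℝ) (l : Fin L) {v : ℝ}
    (hv : 0 ≤ v) :
    volume (sector L x φ l ∩ Metric.ball x (sectorRadius L v)) = ENNReal.ofReal v := by
  have hL : (L : ℝ) ≠ 0 := by exact_mod_cast (Fin.pos l).ne'
  have := Real.pi_pos.ne'
  rw [sectorRadius, volume_sector_inter_ball x φ l (Real.sqrt_nonneg _),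
    Real.sq_sqrt (by positivity)]
  congr 1
  field_simp

/-- An eavesdropper inside the truncated sector confines the clear part to a strictly smaller
radius; without one, the clear part contains the whole truncated sector. -/
lemma ofReal_le_volume_clearSector_iff {L : ℕ} {x : Plane} {φ : ℝ} {e : ℕ → Plane} {l : Fin L}
    {v : ℝ} (hv : 0 ≤ v) : ENNReal.ofReal v ≤ volume (clearSector L x φ e l) ↔
      ∀ k, e k ∉ sector L x φ l ∩ Metric.ball x (sectorRadius L v) := by
  have hL : (0 : ℝ) < L := by exact_mod_cast (Fin.pos l)
  rw [← volume_sector_inter_ball_sectorRadius x φ l hv]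
  constructor
  · rintro h k ⟨hk, hk'⟩
    refine h.not_gt ?_
    rw [Metric.mem_ball'] at hk'
    have hsub : clearSector L x φ e l ⊆ sector L x φ l ∩ Metric.ball x (dist x (e k)) :=
      fun y hy => ⟨hy.1, Metric.mem_ball'.2 (hy.2 k hk)⟩
    refine (measure_mono hsub).trans_lt ?_
    have h0 : 0 < sectorRadius L v := dist_nonneg.trans_lt hk'
    rw [volume_sector_inter_ball x φ l dist_nonneg, volume_sector_inter_ball x φ l h0.le,
      ENNReal.ofReal_lt_ofReal_iff (by have := Real.pi_pos; positivity)]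
    have := Real.pi_pos
    gcongr
  · intro h
    refine measure_mono fun y hy => ⟨hy.1, fun k hk => ?_⟩
    have h1 : ¬ dist x (e k) < sectorRadius L v := fun h2 => h k ⟨hk, Metric.mem_ball'.2 h2⟩
    exact (Metric.mem_ball'.1 hy.2).trans_le (not_lt.1 h1)

lemma Measurable.volume_clearSector {α : Type*} [MeasurableSpace α] {L : ℕ} {x : α → Plane}
    {φ : α → ℝ} {e : α → ℕ → Plane} (hx : Measurable x) (hφ : Measurable φ) (he : Measurable e)
    (l : Fin L) : Measurable fun a => volume (clearSector L (x a) (φ a) (e a) l) :=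
  measurable_measure_prodMk_left ((hx.comp measurable_fst).mem_clearSector
    (hφ.comp measurable_fst) (he.comp measurable_fst) measurable_snd l)

section ClearArea

variable {Ω : Type*} [MeasurableSpace Ω] {μ : Measure Ω}
  {E : ℕ → Ω → Plane} {lamE : ℝ} {L : ℕ}

lemma IsPoissonProcess.measure_le_volume_clearSector (hE : IsPoissonProcess μ E lamE)
    (x : Plane) (φ : ℝ) (l : Fin L) {v : ℝ} (hv : 0 ≤ v) :
    μ {ω | ENNReal.ofReal v ≤ volume (clearSector L x φ (fun k => E k ω) l)} =
      ENNReal.ofReal (Real.exp (-(lamE * v))) := by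
  have h := volume_sector_inter_ball_sectorRadius x φ l hv
  simp only [ofReal_le_volume_clearSector_iff hv]
  rw [hE.void_prob ((measurableSet_sector L x φ l).inter measurableSet_ball)
    (by rw [h]; exact ENNReal.ofReal_ne_top), measureReal_def, h, ENNReal.toReal_ofReal hv]

/-- An infinite area exceeds every `n`, an event of probability `exp (-lamE * n)`, which tends to
`0`. -/
lemma IsPoissonProcess.measure_volume_clearSector_eq_top (hE : IsPoissonProcess μ E lamE)
    (hlamE : 0 < lamE) (x : Plane) (φ : ℝ) (l : Fin L) :
    μ {ω | volume (clearSector L x φ (fun k => E k ω) l) = ∞} = 0 := by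
  have h1 : ∀ n : ℕ, μ {ω | volume (clearSector L x φ (fun k => E k ω) l) = ∞} ≤
      ENNReal.ofReal (Real.exp (-(lamE * n))) := by
    intro n
    rw [← hE.measure_le_volume_clearSector x φ l n.cast_nonneg]
    exact measure_mono fun ω hω => le_top.trans_eq (Eq.symm hω)
  have h2 : Filter.Tendsto (fun n : ℕ => ENNReal.ofReal (Real.exp (-(lamE * n)))) Filter.atTop
      (nhds (ENNReal.ofReal 0)) := by
    refine ENNReal.tendsto_ofReal (Real.tendsto_exp_neg_atTop_nhds_zero.comp ?_)
    exact tendsto_natCast_atTop_atTop.const_mul_atTop hlamE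
  rw [ENNReal.ofReal_zero] at h2
  exact le_antisymm (ge_of_tendsto' h2 h1) zero_le

lemma IsPoissonProcess.map_volume_clearSector [IsProbabilityMeasure μ]
    (hE : IsPoissonProcess μ E lamE)
    (hlamE : 0 < lamE) (x : Plane) (φ : ℝ) (l : Fin L) :
    μ.map (fun ω => volume (clearSector L x φ (fun k => E k ω) l)) = expLaw lamE := by
  have hm : Measurable fun ω => volume (clearSector L x φ (fun k => E k ω) l) :=
    measurable_const.volume_clearSector measurable_const (measurable_pi_lambda _ hE.measurable) l
  have : IsProbabilityMeasure (μ.map (fun ω => volume (clearSector L x φ (fun k => E k ω) l))) :=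
    Measure.isProbabilityMeasure_map hm.aemeasurable
  refine Measure.ext_of_Ici _ _ fun a => ?_
  rw [Measure.map_apply hm measurableSet_Ici]
  by_cases ha : a = ∞
  · rw [ha, expLaw_Ici_top, ← hE.measure_volume_clearSector_eq_top hlamE x φ l]
    simp [Set.preimage]
  · rw [← ENNReal.ofReal_toReal ha, expLaw_Ici_ofReal hlamE ENNReal.toReal_nonneg,
      ← hE.measure_le_volume_clearSector x φ l ENNReal.toReal_nonneg]
    rfl

/-- It suffices to test on the π-system of events `a l ≤ V l`. For finite thresholds these are void
events of disjoint truncated sectors. -/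
lemma IsPoissonProcess.iIndepFun_volume_clearSector (hE : IsPoissonProcess μ E lamE)
    (hlamE : 0 < lamE) (x : Plane) (φ : ℝ) :
    iIndepFun (fun (l : Fin L) ω => volume (clearSector L x φ (fun k => E k ω) l)) μ := by
  set V : Fin L → Ω → ℝ≥0∞ := fun l ω => volume (clearSector L x φ (fun k => E k ω) l) with hV
  have hm : ∀ l, Measurable (V l) := fun l =>
    measurable_const.volume_clearSector measurable_const (measurable_pi_lambda _ hE.measurable) l
  rw [iIndepFun_iff_iIndep]
  refine iIndepSets.iIndep (fun l => (hm l).comap_le)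
    (fun l => {s | ∃ t ∈ Set.range Set.Ici, V l ⁻¹' t = s})
    (fun l => isPiSystem_Ici.comap (V l)) (fun l => ?_) ?_
  · rw [BorelSpace.measurable_eq (α := ℝ≥0∞), borel_eq_generateFrom_Ici,
      MeasurableSpace.comap_generateFrom]
    rfl
  rw [iIndepSets_iff]
  intro s f hf
  have hf' : ∀ l ∈ s, ∃ a, f l = V l ⁻¹' Set.Ici a := by
    rintro l hl
    obtain ⟨_, ⟨a, rfl⟩, h⟩ := hf l hl
    exact ⟨a, h.symm⟩
  choose! a ha using hf'
  -- An infinite threshold corresponds to no truncated sector, but its event is null and both sides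
  -- vanish.
  by_cases htop : ∃ l ∈ s, a l = ∞
  · obtain ⟨l, hl, hal⟩ := htop
    have h0 : μ (f l) = 0 := by
      rw [ha l hl, hal, ← hE.measure_volume_clearSector_eq_top hlamE x φ l]
      simp [Set.preimage, hV]
    rw [Finset.prod_eq_zero hl h0]
    exact measure_mono_null (Set.biInter_subset_of_mem hl) h0
  · push Not at htop
    set B : Fin L → Set Plane := fun l =>
      sector L x φ l ∩ Metric.ball x (sectorRadius L (a l).toReal) with hB
    have h1 := hE.count_indep L B
      (fun l => (measurableSet_sector L x φ l).inter measurableSet_ball)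
      (fun l => by
        rw [hB]; dsimp only
        rw [volume_sector_inter_ball_sectorRadius x φ l ENNReal.toReal_nonneg]
        exact ENNReal.ofReal_ne_top)
      (fun l m hlm => (sector_disjoint x φ hlm).mono Set.inter_subset_left Set.inter_subset_left)
    have h2 : ∀ l ∈ s, f l = pointCount E (B l) ⁻¹' {0} := by
      intro l hl
      ext ω
      rw [ha l hl, Set.mem_preimage, Set.mem_Ici, ← ENNReal.ofReal_toReal (htop l hl), hV]
      dsimp only
      rw [ofReal_le_volume_clearSector_iff ENNReal.toReal_nonneg, Set.mem_preimage,
        Set.mem_singleton_iff, pointCount, Set.encard_eq_zero, Set.eq_empty_iff_forall_notMem]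
      rfl
    rw [Set.iInter₂_congr h2, h1.measure_inter_preimage_eq_mul s
      (sets := fun _ => {0}) (fun l _ => measurableSet_singleton 0)]
    exact Finset.prod_congr rfl fun l hl => by rw [h2 l hl]

lemma IsPoissonProcess.lintegral_poissonProb_clearArea [IsProbabilityMeasure μ]
    (hE : IsPoissonProcess μ E lamE)
    (hlamE : 0 < lamE) {lamL : ℝ} (hlamL : 0 < lamL) (hL : 1 ≤ L) (x : Plane) (φ : ℝ) (n : ℕ) :
    ∫⁻ ω, ENNReal.ofReal (poissonProb (∑ l : Fin L,
        lamL * (volume (clearSector L x φ (fun k => E k ω) l)).toReal) n) ∂μ =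
      ENNReal.ofReal (((L + n - 1).choose (L - 1) : ℝ) * (lamL / (lamL + lamE)) ^ n *
        (lamE / (lamL + lamE)) ^ L) := by
  set V : Fin L → Ω → ℝ≥0∞ := fun l ω => volume (clearSector L x φ (fun k => E k ω) l) with hV
  have hm : ∀ l, Measurable (V l) := fun l =>
    measurable_const.volume_clearSector measurable_const (measurable_pi_lambda _ hE.measurable) l
  have hg : ∀ k : ℕ, Measurable fun v : ℝ≥0∞ => ENNReal.ofReal (poissonProb (lamL * v.toReal) k) :=
    fun k => by unfold poissonProb; fun_prop
  have hnn : ∀ (v : ℝ≥0∞) (k : ℕ), 0 ≤ poissonProb (lamL * v.toReal) k := fun v k =>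
    poissonProb_nonneg (by positivity) k
  have h1 : ∀ ω, ENNReal.ofReal (poissonProb (∑ l : Fin L, lamL * (V l ω).toReal) n) =
      ∑ k ∈ Finset.univ.piAntidiag n,
        ∏ l, ENNReal.ofReal (poissonProb (lamL * (V l ω).toReal) (k l)) := by
    intro ω
    rw [poissonProb_sum, ENNReal.ofReal_sum_of_nonneg fun k _ =>
      Finset.prod_nonneg fun l _ => hnn _ _]
    exact Finset.sum_congr rfl fun k _ => ENNReal.ofReal_prod_of_nonneg fun l _ => hnn _ _
  -- Every way of distributing `n` points over the sectors has the same probability, so only their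
  -- number matters afterwards.
  have h2 : ∀ k ∈ (Finset.univ : Finset (Fin L)).piAntidiag n,
      ∫⁻ ω, ∏ l, ENNReal.ofReal (poissonProb (lamL * (V l ω).toReal) (k l)) ∂μ =
        ENNReal.ofReal ((lamL / (lamL + lamE)) ^ n * (lamE / (lamL + lamE)) ^ L) := by
    intro k hk
    have hn : ∑ i, k i = n := (Finset.mem_piAntidiag.1 hk).1
    rw [lintegral_prod_eq_prod_lintegral_of_indepFun Finset.univ
      (fun l ω => ENNReal.ofReal (poissonProb (lamL * (V l ω).toReal) (k l)))
      ((hE.iIndepFun_volume_clearSector hlamE x φ).comp _ fun l => hg (k l))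
      fun l => (hg (k l)).comp (hm l)]
    have h3 : ∀ l, ∫⁻ ω, ENNReal.ofReal (poissonProb (lamL * (V l ω).toReal) (k l)) ∂μ =
        ENNReal.ofReal ((lamL / (lamL + lamE)) ^ k l * (lamE / (lamL + lamE))) := by
      intro l
      rw [← lintegral_poissonProb_expLaw hlamE hlamL, ← hE.map_volume_clearSector hlamE x φ l,
        lintegral_map (hg (k l)) (hm l)]
    simp only [h3]
    rw [← ENNReal.ofReal_prod_of_nonneg fun l _ => by positivity, Finset.prod_mul_distrib,
      Finset.prod_pow_eq_pow_sum, hn, Finset.prod_const, Finset.card_univ, Fintype.card_fin]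
  rw [lintegral_congr h1, lintegral_finsetSum _ fun k _ => Finset.measurable_prod _ fun l _ => (hg (k l)).comp (hm l),
    Finset.sum_congr rfl h2, Finset.sum_const, card_piAntidiag_fin hL, nsmul_eq_mul,
    ← ENNReal.ofReal_natCast, ← ENNReal.ofReal_mul (by positivity), mul_assoc]

end ClearArea

/-! ### Law of the out-degree and the theorem -/

lemma measure_outDegree_eq {Ω : Type*} [MeasurableSpace Ω] {μ : Measure Ω} [IsProbabilityMeasure μ]
    {X E : ℕ → Ω → Plane} {lamL lamE : ℝ} (hX : IsPoissonProcess μ X lamL) (hlamL : 0 < lamL)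
    (hE : IsPoissonProcess μ E lamE) (hlamE : 0 < lamE)
    (hXE : IndepFun (fun ω i => X i ω) (fun ω k => E k ω) μ) {ψ : Ω → ℝ} (hψ : Measurable ψ)
    (hXEψ : IndepFun (fun ω => ((fun i => X i ω), (fun k => E k ω))) ψ μ)
    {L : ℕ} (hL : 1 ≤ L) (x : Plane) (n : ℕ) :
    μ {ω | {i | Reaches L x (ψ ω) (fun k => E k ω) (X i ω)}.encard = n} =
      ENNReal.ofReal (((L + n - 1).choose (L - 1) : ℝ) * (lamL / (lamL + lamE)) ^ n *
        (lamE / (lamL + lamE)) ^ L) := by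
  have hXm : Measurable fun ω i => X i ω := measurable_pi_lambda _ hX.measurable
  have hEm : Measurable fun ω k => E k ω := measurable_pi_lambda _ hE.measurable
  have h3 := (indepFun_iff_map_prod_eq_prod_map_map hXm.aemeasurable hEm.aemeasurable).1 hXE
  have h4 := (indepFun_iff_map_prod_eq_prod_map_map (hXm.prodMk hEm).aemeasurable
    hψ.aemeasurable).1 hXEψ
  rw [h3] at h4
  set PX := μ.map (fun ω i => X i ω)
  set PE := μ.map (fun ω k => E k ω)
  set Pψ := μ.map ψ
  have : IsProbabilityMeasure PX := Measure.isProbabilityMeasure_map hXm.aemeasurable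
  have : IsProbabilityMeasure PE := Measure.isProbabilityMeasure_map hEm.aemeasurable
  have : IsProbabilityMeasure Pψ := Measure.isProbabilityMeasure_map hψ.aemeasurable
  let A : Set (((ℕ → Plane) × (ℕ → Plane)) × ℝ) :=
    {p | {i | Reaches L x p.2 p.1.2 (p.1.1 i)}.encard = n}
  have hA : MeasurableSet A := by
    have h : Measurable fun p : ((ℕ → Plane) × (ℕ → Plane)) × ℝ =>
        {i | Reaches L x p.2 p.1.2 (p.1.1 i)}.encard :=
      measurable_encard_setOf fun i => measurable_const.reaches measurable_snd
        (measurable_snd.comp measurable_fst)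
        ((measurable_pi_apply i).comp (measurable_fst.comp measurable_fst))
    exact h (measurableSet_singleton _)
  have h5 : μ {ω | {i | Reaches L x (ψ ω) (fun k => E k ω) (X i ω)}.encard = n} =
      ((PX.prod PE).prod Pψ) A := by
    rw [← h4, Measure.map_apply ((hXm.prodMk hEm).prodMk hψ) hA]
    rfl
  have h6 : ∀ φ, (PX.prod PE) ((fun p => (p, φ)) ⁻¹' A) =
      ENNReal.ofReal (((L + n - 1).choose (L - 1) : ℝ) * (lamL / (lamL + lamE)) ^ n *
        (lamE / (lamL + lamE)) ^ L) := by
    intro φ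
    have hAφ := measurable_prodMk_right (y := φ) hA
    rw [Measure.prod_apply_symm hAφ, lintegral_map (measurable_measure_prodMk_right hAφ) hEm,
      ← hE.lintegral_poissonProb_clearArea hlamE hlamL hL x φ n]
    refine lintegral_congr_ae ?_
    have hfin : ∀ᵐ ω ∂μ, ∀ l : Fin L, volume (clearSector L x φ (fun k => E k ω) l) ≠ ∞ := by
      refine ae_all_iff.2 fun l => ?_
      rw [ae_iff]
      simpa using hE.measure_volume_clearSector_eq_top hlamE x φ l
    filter_upwards [hfin] with ω hω
    -- With angle and eavesdroppers fixed, the reachable set is a deterministic Borel set of finite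
    -- area, to which the count law of `X` applies.
    have hB : MeasurableSet {y | Reaches L x φ (fun k => E k ω) y} :=
      measurable_const.reaches measurable_const measurable_const measurable_id
    have hv := volume_setOf_reaches L x φ (fun k => E k ω)
    have hv' : volume {y | Reaches L x φ (fun k => E k ω) y} ≠ ∞ := by
      rw [hv]
      exact ENNReal.sum_ne_top.2 fun l _ => hω l
    have hc := hX.count_law _ hB hv' n
    rw [Measure.map_apply hXm (measurable_prodMk_right hAφ)]
    refine hc.trans ?_
    rw [measureReal_def, hv, ENNReal.toReal_sum fun l _ => hω l, Finset.mul_sum]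
    rfl
  rw [h5, Measure.prod_apply_symm hA]
  simp only [h6, lintegral_const, measure_univ, mul_one]

theorem mainTheorem7 {Ω : Type*} [MeasurableSpace Ω] (μ : Measure Ω) [IsProbabilityMeasure μ]
    (L : ℕ) (hL : 1 ≤ L) (lamL lamE : ℝ) (hlamL : 0 < lamL) (hlamE : 0 < lamE)
    (X E : ℕ → Ω → Plane) (Φ : ℕ → Ω → ℝ)
    (hX : IsPoissonProcess μ X lamL) (hE : IsPoissonProcess μ E lamE)
    (hΦ : ∀ i, Measurable (Φ i))
    (hXE : IndepFun (fun ω i => X i ω) (fun ω k => E k ω) μ)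
    (hXEΦ : IndepFun (fun ω => ((fun i => X i ω), (fun k => E k ω))) (fun ω i => Φ i ω) μ) :
    Measurable (fun ω => outDegree (typicalGraph L X E Φ ω) 0) ∧
    Measurable (fun ω => inDegree (typicalGraph L X E Φ ω) 0) ∧
    (∀ n : ℕ, μ {ω | outDegree (typicalGraph L X E Φ ω) 0 = n} =
      ENNReal.ofReal (((L + n - 1).choose (L - 1) : ℝ) * (lamL / (lamL + lamE)) ^ n *
        (lamE / (lamL + lamE)) ^ L)) ∧
    ∫⁻ ω, (outDegree (typicalGraph L X E Φ ω) 0 : ℝ≥0∞) ∂μ = ENNReal.ofReal (L * lamL / lamE) ∧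
    ∫⁻ ω, (inDegree (typicalGraph L X E Φ ω) 0 : ℝ≥0∞) ∂μ = ENNReal.ofReal (L * lamL / lamE) := by
  have hEm : Measurable fun ω k => E k ω := measurable_pi_lambda _ hE.measurable
  have hXEψ : ∀ i, IndepFun (fun ω => ((fun i => X i ω), (fun k => E k ω))) (Φ i) μ := fun i =>
    hXEΦ.comp measurable_id (measurable_pi_apply i)
  have hout : ∀ i, MeasurableSet {ω | Reaches L 0 (Φ 0 ω) (fun k => E k ω) (X i ω)} := fun i =>
    measurable_const.reaches (hΦ 0) hEm (hX.measurable i)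
  have hin : ∀ i, MeasurableSet {ω | Reaches L (X i ω) (Φ (i + 1) ω) (fun k => E k ω) 0} :=
    fun i => (hX.measurable i).reaches (hΦ (i + 1)) hEm measurable_const
  simp only [outDegree_typicalGraph, inDegree_typicalGraph]
  refine ⟨measurable_encard_setOf hout, measurable_encard_setOf hin,
    measure_outDegree_eq hX hlamL hE hlamE hXE (hΦ 0) (hXEψ 0) hL 0, ?_, ?_⟩
  -- Outgoing edges all use the angle `Φ 0`; an incoming edge from `X i` uses `Φ (i + 1)`, the index
  -- being shifted by the added node.
  · rw [lintegral_encard_setOf μ hout]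
    exact tsum_measure_reaches hX hlamL.le hE hlamE hXE (fun _ => hΦ 0) (fun _ => hXEψ 0) hL
      (s := fun _ => 0) (t := id) measurable_const measurable_id (fun x => dist_zero_left x)
      (ae_mem_sector hL 0)
  · rw [lintegral_encard_setOf μ hin]
    exact tsum_measure_reaches hX hlamL.le hE hlamE hXE (fun i => hΦ (i + 1))
      (fun i => hXEψ (i + 1)) hL (s := id) (t := fun _ => 0) measurable_id measurable_const
      (fun x => dist_zero_right x) (ae_zero_mem_sector hL)
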